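/- Let $\mathbb{H}$ be the quaternions and let $\mathbb{HP}^2=(\mathbb{H}^3\setminus\{0\})/\mathbb{H}^\times$, where $\mathbb{H}^\times$ acts by right multiplication. Represent a point of $\mathbb{HP}^2$ by a unit vector $x\in\mathbb{H}^3$, with projection matrix $\Pi_x=xx^\dagger$; for Hermitian matrices put $\langle A,B\rangle=\operatorname{Re}\operatorname{Tr}(AB)$, so that $\langle\Pi_x,\Pi_y\rangle=|x^\dagger y|^2$, and let $\rho(x,y)=\sqrt{1-\langle\Pi_x,\Pi_y\rangle}$ be the chordal distance. A tight simplex of $N$ points in $\mathbb{HP}^{2}$ is a collection of $N$ distinct points $x_1,\dots,x_N$ whose distances $\rho(x_i,x_j)$, $i\ne j$, are all equal and whose common inner product is $\langle \Pi_{x_i},\Pi_{x_j}\rangle=\frac{N-3}{3(N-1)}$ for $i\neq j$. **Theorem.** There is a tight simplex of $12$ points in $\mathbb{HP}^2$. In fact, there is such a tight simplex with cyclic symmetry, that is, such that whenever the point represented by $(a,b,c)$ belongs to it, so do the points represented by $(b,c,a)$ and $(c,a,b)$, and these three points of $\mathbb{HP}^2$ are distinct. -/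

import Mathlib

open scoped Quaternion

noncomputable section

namespace TightSimplex

/-- Quaternionic projective space `ℍℙ^{d-1}`: the nonzero vectors of `ℍ^d` modulo the
*right* action `x ↦ x α` of the nonzero quaternions.  A right scalar `α` is an element
`MulOpposite.op α` of `ℍᵐᵒᵖ`, so that `MulOpposite.op α • x = fun i => x i * α`. -/
abbrev HP (d : ℕ) : Type := Projectivization (ℍ[ℝ])ᵐᵒᵖ (Fin d → ℍ[ℝ])

/-- The squared length `|x|² = ∑ i, |x i|²` of a vector of `ℍ^d`. -/
def vecNormSq {d : ℕ} (x : Fin d → ℍ[ℝ]) : ℝ := ∑ i, Quaternion.normSq (x i)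

/-- The Hermitian inner product `⟨x, y⟩ = x† y` on `ℍ^d`. -/
def herm {d : ℕ} (x y : Fin d → ℍ[ℝ]) : ℍ[ℝ] := ∑ i, star (x i) * y i

/-- The matrix `x x† / |x|²`, which is `x x†` for a unit vector `x`. -/
def vecProjMatrix {d : ℕ} (x : Fin d → ℍ[ℝ]) : Matrix (Fin d) (Fin d) ℍ[ℝ] :=
  (vecNormSq x)⁻¹ • Matrix.of fun i j => x i * star (x j)

theorem vecProjMatrix_smul {d : ℕ} (x : Fin d → ℍ[ℝ]) (t : (ℍ[ℝ])ᵐᵒᵖ) (ht : t ≠ 0) :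
    vecProjMatrix (t • x) = vecProjMatrix x := by
  have h0 : Quaternion.normSq t.unop ≠ 0 := by
    rw [Ne, Quaternion.normSq_eq_zero]
    exact (MulOpposite.unop_ne_zero_iff t).2 ht
  have h1 : vecNormSq (t • x) = vecNormSq x * Quaternion.normSq t.unop := by
    simp [vecNormSq, Finset.sum_mul]
  have h2 : ∀ i j, (t • x) i * star ((t • x) j)
      = Quaternion.normSq t.unop • (x i * star (x j)) := by
    intro i j
    have h3 : (t • x) i * star ((t • x) j)
        = x i * (t.unop * star t.unop) * star (x j) := by
      simp [mul_assoc]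
    rw [h3, Quaternion.self_mul_star, ← Quaternion.coe_mul_eq_smul,
      ← Quaternion.coe_commutes, mul_assoc]
  ext1 i j
  simp only [vecProjMatrix, Matrix.smul_apply, Matrix.of_apply, h1, h2, smul_smul]
  congr 1
  field_simp

/-- The projection matrix `Π = x x†` (`x` a unit representative) of a point of `ℍℙ^{d-1}`. -/
def projMatrix {d : ℕ} (p : HP d) : Matrix (Fin d) (Fin d) ℍ[ℝ] :=
  Projectivization.lift (fun v : { v : Fin d → ℍ[ℝ] // v ≠ 0 } => vecProjMatrix v.1)
    (by
      intro a b t h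
      have ht : t ≠ 0 := by
        rintro rfl
        exact a.2 (by rw [h, zero_smul])
      change vecProjMatrix a.1 = vecProjMatrix b.1
      rw [h, vecProjMatrix_smul b.1 t ht]) p

/-- The real inner product `⟨A, B⟩ = Re Tr (A B)` on Hermitian matrices. -/
def matInner {d : ℕ} (A B : Matrix (Fin d) (Fin d) ℍ[ℝ]) : ℝ := (A * B).trace.re

/-- The chordal distance `ρ(p, q) = √(1 - ⟨Π_p, Π_q⟩)` on `ℍℙ^{d-1}`. -/
def chordalDist {d : ℕ} (p q : HP d) : ℝ :=
  Real.sqrt (1 - matInner (projMatrix p) (projMatrix q))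

/-- For unit representatives, `⟨Π_x, Π_y⟩ = |⟨x, y⟩|²`. -/
theorem matInner_projMatrix_mk {d : ℕ} (x y : Fin d → ℍ[ℝ]) (hx : x ≠ 0) (hy : y ≠ 0)
    (hx1 : vecNormSq x = 1) (hy1 : vecNormSq y = 1) :
    matInner (projMatrix (Projectivization.mk _ x hx)) (projMatrix (Projectivization.mk _ y hy))
      = ‖herm x y‖ ^ 2 := by
  have hre : ∀ a b : ℍ[ℝ], (a * b).re = (b * a).re := by
    intro a b
    simp only [Quaternion.re_mul]
    ring
  have key : ‖herm x y‖ ^ 2 = (herm x y * star (herm x y)).re := by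
    rw [Quaternion.self_mul_star, Quaternion.re_coe, Quaternion.normSq_eq_norm_mul_self, sq]
  have hs : ∀ s : Finset (Fin d), ∀ f : Fin d → ℍ[ℝ], (∑ i ∈ s, f i).re = ∑ i ∈ s, (f i).re := by
    intro s f
    classical
    induction s using Finset.induction_on with
    | empty => simp
    | insert a s ha ih => rw [Finset.sum_insert ha, Finset.sum_insert ha, Quaternion.re_add, ih]
  rw [key]
  simp only [projMatrix, Projectivization.lift_mk, vecProjMatrix, hx1, hy1, inv_one, one_smul,
    matInner, Matrix.trace, Matrix.diag_apply, Matrix.mul_apply, Matrix.of_apply, herm, star_sum,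
    star_mul, star_star, Finset.sum_mul_sum, hs]
  rw [Finset.sum_comm]
  refine Finset.sum_congr rfl fun j _ => Finset.sum_congr rfl fun i _ => ?_
  have e : x i * star (x j) * (y j * star (y i)) = x i * (star (x j) * y j * star (y i)) := by
    simp only [mul_assoc]
  rw [e, hre, mul_assoc]

/-- For unit representatives, `ρ(x, y) = √(1 - |⟨x, y⟩|²)`. -/
theorem chordalDist_mk {d : ℕ} (x y : Fin d → ℍ[ℝ]) (hx : x ≠ 0) (hy : y ≠ 0)
    (hx1 : vecNormSq x = 1) (hy1 : vecNormSq y = 1) :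
    chordalDist (Projectivization.mk _ x hx) (Projectivization.mk _ y hy)
      = Real.sqrt (1 - ‖herm x y‖ ^ 2) := by
  rw [chordalDist, matInner_projMatrix_mk x y hx hy hx1 hy1]

/-- A regular simplex of `N` points in `ℍℙ^{d-1}`: distinct points `x_1, …, x_N` with all the
chordal distances `ρ(x_i, x_j)`, `i ≠ j`, equal. -/
def IsRegularSimplex {d N : ℕ} (x : Fin N → HP d) : Prop :=
  Function.Injective x ∧
    ∀ i j k l : Fin N, i ≠ j → k ≠ l → chordalDist (x i) (x j) = chordalDist (x k) (x l)

/-- A tight simplex of `N` points in `ℍℙ^{d-1}`: a regular simplex whose common inner product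
`α = ⟨Π_i, Π_j⟩`, `i ≠ j`, equals `(N - d) / (d (N - 1))`. -/
def IsTightSimplex {d N : ℕ} (x : Fin N → HP d) : Prop :=
  IsRegularSimplex x ∧
    ∀ i j : Fin N, i ≠ j → matInner (projMatrix (x i)) (projMatrix (x j))
      = ((N : ℝ) - (d : ℝ)) / ((d : ℝ) * ((N : ℝ) - 1))

/-- The coordinate shift `(a, b, c) ↦ (b, c, a)` of `ℍ³`, linear for the right scalar action. -/
def shiftLinear : (Fin 3 → ℍ[ℝ]) →ₗ[(ℍ[ℝ])ᵐᵒᵖ] (Fin 3 → ℍ[ℝ]) :=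
  LinearMap.funLeft (ℍ[ℝ])ᵐᵒᵖ ℍ[ℝ] (fun i : Fin 3 => i + 1)

theorem shiftLinear_apply (a b c : ℍ[ℝ]) : shiftLinear ![a, b, c] = ![b, c, a] := by
  ext1 i
  fin_cases i <;> rfl

theorem shiftLinear_injective : Function.Injective shiftLinear :=
  LinearMap.funLeft_injective_of_surjective _ _ _ (fun i => ⟨i - 1, sub_add_cancel i 1⟩)

/-- The cyclic shift `σ [a : b : c] = [b : c : a]` of `ℍℙ²`. -/
def cyclicShift : HP 3 → HP 3 :=
  Projectivization.map shiftLinear shiftLinear_injective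

/-- Cyclic symmetry of a set of points of `ℍℙ²`: with each point `[a : b : c]` it contains
`[b : c : a]` and `[c : a : b]`, and these three points are distinct. -/
def IsCyclicSymmetric (S : Set (HP 3)) : Prop :=
  ∀ p ∈ S, cyclicShift p ∈ S ∧ cyclicShift (cyclicShift p) ∈ S ∧
    p ≠ cyclicShift p ∧ p ≠ cyclicShift (cyclicShift p) ∧
    cyclicShift p ≠ cyclicShift (cyclicShift p)

end TightSimplex

end

noncomputable section

namespace TightSimplex

/-! The twelve points are the cyclic shifts of four vectors `twistVec q u v`, with q = 1 or j and
two choices of the pair (u, v). Twisting the entries by powers of a unit ω of order three makes the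
squared inner product across a nontrivial shift the average of the squared Hermitian and bilinear
products of complex vectors. Hence q drops out there, and real equations for two pairs remain
(`exists_isTightSimplex_of_shiftDot`).

In coordinates along the axis and the plane of the shift, shifting rotates the plane by 120°. The
squared products between the two pairs form a trigonometric polynomial in that angle; its constant
term is 3/11 and its other coefficients must vanish, which is one complex equation (`sq_sum_cross`).
Turning the second pair by φ brings this equation to the form e^{3iφ} K = L.

All other conditions are solved explicitly in a parameter s, with one degree of freedom spent on
making |K| = |L| for every s (`modulus_eq`). The intermediate value theorem equates the real parts;
the moduli and a sign then give the imaginary parts. -/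

/-! ### Twisted quaternionic vectors and their inner products. -/

/-- The sum `∑ k, u k * v (k + s)`: the inner product of `u` with the `s`-th cyclic shift of `v`. -/
def shiftDot (s : Fin 3) (u v : Fin 3 → ℝ) : ℝ := ∑ k, u k * v (k + s)

/-- The quaternion `a + b i + c j + d k`. -/
def quat (a b c d : ℝ) : ℍ[ℝ] := ⟨a, b, c, d⟩

section quat

variable (a b c d : ℝ)

@[simp] theorem quat_re : (quat a b c d).re = a := rfl

@[simp] theorem quat_imI : (quat a b c d).imI = b := rfl

@[simp] theorem quat_imJ : (quat a b c d).imJ = c := rfl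

@[simp] theorem quat_imK : (quat a b c d).imK = d := rfl

@[simp] theorem normSq_quat :
    Quaternion.normSq (quat a b c d) = a ^ 2 + b ^ 2 + c ^ 2 + d ^ 2 := by
  simp [Quaternion.normSq_def']

end quat

/-- The quaternion `a + b i`. -/
abbrev cquat (a b : ℝ) : ℍ[ℝ] := quat a b 0 0

/-- Split q along ℍ = ℂ ⊕ ℂj. Complex numbers commute with the first part and are conjugated on
passing the second, so the first meets the Hermitian product and the second the bilinear one; the
two contributions are orthogonal. -/
theorem normSq_sum_cquat (q : ℍ[ℝ]) (s : Fin 3) (u v u' v' : Fin 3 → ℝ) :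
    Quaternion.normSq (∑ k, star (cquat (u k) (v k)) * q * cquat (u' (k + s)) (v' (k + s))) =
      (q.re ^ 2 + q.imI ^ 2) * ((shiftDot s u u' + shiftDot s v v') ^ 2
        + (shiftDot s u v' - shiftDot s v u') ^ 2)
      + (q.imJ ^ 2 + q.imK ^ 2) * ((shiftDot s u u' - shiftDot s v v') ^ 2
        + (shiftDot s u v' + shiftDot s v u') ^ 2) := by
  have h : (∑ k, star (cquat (u k) (v k)) * q * cquat (u' (k + s)) (v' (k + s))) =
      cquat (shiftDot s u u' + shiftDot s v v') (shiftDot s u v' - shiftDot s v u')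
          * cquat q.re q.imI
        + cquat (shiftDot s u u' - shiftDot s v v') (-(shiftDot s u v' + shiftDot s v u'))
          * quat 0 0 q.imJ q.imK := by
    simp only [shiftDot, Fin.sum_univ_three]
    ext <;> simp <;> ring
  rw [h]
  rw [Quaternion.normSq_def']
  simp
  ring

/-- The element `(-1 + i + j + k) / 2` of order three. -/
def cubeUnit : ℍ[ℝ] := quat (-1 / 2) (1 / 2) (1 / 2) (1 / 2)

/-- The conjugates of the powers of `cubeUnit`. -/
def twist : Fin 3 → ℍ[ℝ] := ![1, star cubeUnit, cubeUnit]

/-- `twist` is a homomorphism from ℤ/3 to the unit quaternions, so the twist across a shift does not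
depend on the coordinate. -/
theorem star_twist_mul_twist (k s : Fin 3) : star (twist k) * twist (k + s) = twist s := by
  fin_cases k <;> fin_cases s <;> simp [twist] <;> ext <;> simp [cubeUnit] <;> norm_num

/-- The vector with entries `twist k * q * (u k + v k i)`. -/
def twistVec (q : ℍ[ℝ]) (u v : Fin 3 → ℝ) : Fin 3 → ℍ[ℝ] :=
  fun k => twist k * q * cquat (u k) (v k)

theorem herm_twistVec (q q' : ℍ[ℝ]) (u v u' v' : Fin 3 → ℝ) (s : Fin 3) :
    herm (twistVec q u v) (fun k => twistVec q' u' v' (k + s)) =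
      ∑ k, star (cquat (u k) (v k)) * (star q * twist s * q') *
        cquat (u' (k + s)) (v' (k + s)) := by
  refine Finset.sum_congr rfl fun k _ => ?_
  rw [← star_twist_mul_twist k s]
  simp only [twistVec, star_mul, mul_assoc]

theorem herm_shift_shift (x y : Fin 3 → ℍ[ℝ]) (s t : Fin 3) :
    herm (fun k => x (k + s)) (fun k => y (k + t)) = herm x (fun k => y (k + (t - s))) := by
  unfold herm
  rw [← Equiv.sum_comp (Equiv.addRight s) (fun k => star (x k) * y (k + (t - s)))]
  refine Finset.sum_congr rfl fun k _ => ?_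
  have e : k + s + (t - s) = k + t := by abel
  simp [e]

theorem vecNormSq_shift (x : Fin 3 → ℍ[ℝ]) (s : Fin 3) :
    vecNormSq (fun k => x (k + s)) = vecNormSq x :=
  Equiv.sum_comp (Equiv.addRight s) (fun k => Quaternion.normSq (x k))

theorem vecNormSq_twistVec (q : ℍ[ℝ]) (hq : Quaternion.normSq q = 1) (u v : Fin 3 → ℝ) :
    vecNormSq (twistVec q u v) = shiftDot 0 u u + shiftDot 0 v v := by
  have ht : ∀ k, Quaternion.normSq (twist k) = 1 := by
    intro k
    fin_cases k <;> simp [twist, cubeUnit] <;> norm_num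
  have hc : ∀ a b : ℝ, Quaternion.normSq (cquat a b) = a * a + b * b := by
    intro a b
    simp
    ring
  simp [vecNormSq, twistVec, ht, hq, hc, shiftDot, Finset.sum_add_distrib]

theorem ne_zero_of_vecNormSq_eq_one {x : Fin 3 → ℍ[ℝ]} (h : vecNormSq x = 1) : x ≠ 0 := by
  rintro rfl
  simp [vecNormSq] at h

/-! ### Reduction to real vectors. -/

/-- Four unit vectors whose cyclic shifts have squared inner products `3/11` give a tight simplex. -/
theorem exists_isTightSimplex_of_shifts (x : Fin 4 → Fin 3 → ℍ[ℝ])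
    (h1 : ∀ a, vecNormSq (x a) = 1)
    (h2 : ∀ a b s, (a ≠ b ∨ s ≠ 0) →
      Quaternion.normSq (herm (x a) (fun k => x b (k + s))) = 3 / 11) :
    ∃ y : Fin 12 → HP 3, IsTightSimplex y ∧ IsCyclicSymmetric (Set.range y) := by
  have hn : ∀ a s, vecNormSq (fun k => x a (k + s)) = 1 := fun a s => by
    rw [vecNormSq_shift, h1]
  let z : Fin 4 × Fin 3 → HP 3 := fun p =>
    Projectivization.mk _ (fun k => x p.1 (k + p.2)) (ne_zero_of_vecNormSq_eq_one (hn p.1 p.2))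
  have hin : ∀ p r, p ≠ r → matInner (projMatrix (z p)) (projMatrix (z r)) = 3 / 11 := by
    rintro ⟨a, s⟩ ⟨b, t⟩ hpr
    rw [matInner_projMatrix_mk _ _ _ _ (hn a s) (hn b t), herm_shift_shift, sq,
      ← Quaternion.normSq_eq_norm_mul_self]
    refine h2 a b (t - s) ?_
    by_contra! hc
    exact hpr (by rw [hc.1, sub_eq_zero.1 hc.2])
  have hself : ∀ p, matInner (projMatrix (z p)) (projMatrix (z p)) = 1 := by
    rintro ⟨a, s⟩
    rw [matInner_projMatrix_mk _ _ _ _ (hn a s) (hn a s)]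
    have e : herm (fun k => x a (k + s)) (fun k => x a (k + s)) = ((1 : ℝ) : ℍ[ℝ]) := by
      rw [← hn a s]
      simp only [herm, vecNormSq, Quaternion.star_mul_self]
      exact (map_sum (algebraMap ℝ ℍ[ℝ]) _ _).symm
    simp [e]
  have hinj : Function.Injective z := by
    intro p r hpr
    by_contra hne
    have h3 := hin p r hne
    rw [hpr, hself] at h3
    norm_num at h3
  have hshift : ∀ a s, cyclicShift (z (a, s)) = z (a, s + 1) := by
    intro a s
    have e : shiftLinear (fun k => x a (k + s)) = fun k => x a (k + (s + 1)) := by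
      funext k
      change x a (k + 1 + s) = _
      congr 1
      abel
    simp only [cyclicShift, z, Projectivization.map_mk, e]
  let ι : Fin 12 ≃ Fin 4 × Fin 3 := (finProdFinEquiv (m := 4) (n := 3)).symm
  refine ⟨z ∘ ι, ⟨⟨hinj.comp ι.injective, ?_⟩, ?_⟩, ?_⟩
  · intro i j k l hij hkl
    simp only [chordalDist, Function.comp_apply]
    rw [hin _ _ (ι.injective.ne hij),
      hin _ _ (ι.injective.ne hkl)]
  · intro i j hij
    simp only [Function.comp_apply]
    rw [hin _ _ (ι.injective.ne hij)]
    norm_num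
  · rw [Set.range_comp, ι.surjective.range_eq, Set.image_univ]
    rintro _ ⟨⟨a, s⟩, rfl⟩
    have hd : ∀ s t : Fin 3, s ≠ t → z (a, s) ≠ z (a, t) := fun s t hst h =>
      hst (Prod.ext_iff.1 (hinj h)).2
    rw [hshift, hshift]
    refine ⟨⟨_, rfl⟩, ⟨_, rfl⟩, hd _ _ ?_, hd _ _ ?_, hd _ _ ?_⟩ <;> revert s <;> decide

/-- Conditions on the real vectors `u, v, u', v'` under which `u + v i` and `u' + v' i` generate
a tight simplex. -/
theorem exists_isTightSimplex_of_shiftDot (u v : Fin 2 → Fin 3 → ℝ)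
    (hn : ∀ m, shiftDot 0 (u m) (u m) + shiftDot 0 (v m) (v m) = 1)
    (hb : ∀ m, (shiftDot 0 (u m) (u m) - shiftDot 0 (v m) (v m)) ^ 2
      + (2 * shiftDot 0 (u m) (v m)) ^ 2 = 3 / 11)
    (hd : shiftDot 0 (u 0) (u 1) * shiftDot 0 (v 0) (v 1)
      = shiftDot 0 (u 0) (v 1) * shiftDot 0 (v 0) (u 1))
    (hs : ∀ m m' s, (m ≠ m' ∨ s ≠ 0) →
      shiftDot s (u m) (u m') ^ 2 + shiftDot s (v m) (v m') ^ 2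
      + shiftDot s (u m) (v m') ^ 2 + shiftDot s (v m) (u m') ^ 2 = 3 / 11) :
    ∃ y : Fin 12 → HP 3, IsTightSimplex y ∧ IsCyclicSymmetric (Set.range y) := by
  have hc : ∀ x y : Fin 3 → ℝ, shiftDot 0 x y = shiftDot 0 y x := fun x y => by
    simp [shiftDot, mul_comm]
  have hd' : ∀ m m', m ≠ m' → shiftDot 0 (u m) (u m') * shiftDot 0 (v m) (v m')
      = shiftDot 0 (u m) (v m') * shiftDot 0 (v m) (u m') := by
    intro m m' hm
    fin_cases m <;> fin_cases m' <;> simp at hm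
    · exact hd
    · simpa [hc (u 1) (u 0), hc (v 1) (v 0), hc (u 1) (v 0), hc (v 1) (u 0), mul_comm] using hd
  let e : Fin 2 → ℍ[ℝ] := ![1, quat 0 0 1 0]
  have he : ∀ i, Quaternion.normSq (e i) = 1 := by
    intro i
    fin_cases i <;> simp [e]
  let ι : Fin 4 ≃ Fin 2 × Fin 2 := (finProdFinEquiv (m := 2) (n := 2)).symm
  refine exists_isTightSimplex_of_shifts
    (fun a => twistVec (e (ι a).2) (u (ι a).1) (v (ι a).1)) ?_ ?_
  · intro a
    rw [vecNormSq_twistVec _ (he _), hn]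
  · intro a b s hab
    have hab' : ι a ≠ ι b ∨ s ≠ 0 := hab.imp_left fun h => ι.injective.ne h
    rw [herm_twistVec, normSq_sum_cquat]
    generalize ι a = p at hab' ⊢
    generalize ι b = r at hab' ⊢
    obtain ⟨m, i⟩ := p
    obtain ⟨m', i'⟩ := r
    by_cases hs0 : s = 0
    · subst hs0
      by_cases hm : m = m'
      · subst hm
        have hii : i ≠ i' := by
          rintro rfl
          simp at hab'
        have h3 := hb m
        have h4 := hc (v m) (u m)
        fin_cases i <;> fin_cases i' <;> simp at hii <;>
          simp [e, twist, h4] <;> linear_combination h3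
      · have h3 := hs m m' 0 (Or.inl hm)
        have h4 := hd' m m' hm
        -- The Hermitian product occurs for equal q and the bilinear one for different q. `h3` gives
        -- the sum of their squared moduli and `h4` says that these agree.
        fin_cases i <;> fin_cases i' <;> simp [e, twist]
        · linear_combination h3 + 2 * h4
        · linear_combination h3 - 2 * h4
        · linear_combination h3 - 2 * h4
        · linear_combination h3 + 2 * h4
    · have h3 := hs m m' s (Or.inr hs0)
      fin_cases s
      · simp at hs0
      -- Multiplying `twist s` by 1 or ±j only permutes its coordinates ±1/2 up to sign, so both
      -- weights in `normSq_sum_cquat` are 1/2.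
      all_goals
        fin_cases i <;> fin_cases i' <;> simp [e, twist, cubeUnit] <;>
          simp at h3 <;> linear_combination h3

/-! ### Coordinates along the axis and plane of the shift. -/

/-- The vector of `ℝ³` with coordinates `(a, x, y)` in an orthonormal basis whose first vector
is `(1, 1, 1) / √3`. -/
def axisVec (a x y : ℝ) : Fin 3 → ℝ :=
  ![(a + √2 * x) * (√3)⁻¹, (a + √2 * (-x / 2 + √3 / 2 * y)) * (√3)⁻¹,
    (a + √2 * (-x / 2 - √3 / 2 * y)) * (√3)⁻¹]

theorem shiftDot_zero_axisVec (a x y b z w : ℝ) :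
    shiftDot 0 (axisVec a x y) (axisVec b z w) = a * b + x * z + y * w := by
  have h2 : √(2 : ℝ) ^ 2 = 2 := Real.sq_sqrt (by norm_num)
  have h3 : √(3 : ℝ) ^ 2 = 3 := Real.sq_sqrt (by norm_num)
  have hc : (√(3 : ℝ))⁻¹ ^ 2 = 1 / 3 := by rw [inv_pow, h3]; norm_num
  simp only [shiftDot, Fin.sum_univ_three, axisVec]
  simp
  linear_combination (3 * a * b + √2 ^ 2 * (3 / 2 * x * z + √3 ^ 2 / 2 * y * w)) * hc
    + 1 / 3 * (3 / 2 * x * z + √3 ^ 2 / 2 * y * w) * h2 + 1 / 3 * y * w * h3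

theorem shiftDot_axisVec {s : Fin 3} (hs : s ≠ 0) : ∃ t : ℝ, t ^ 2 = 3 / 4 ∧ ∀ a x y b z w : ℝ,
    shiftDot s (axisVec a x y) (axisVec b z w)
      = a * b - (x * z + y * w) / 2 + t * (x * w - y * z) := by
  have h2 : √(2 : ℝ) ^ 2 = 2 := Real.sq_sqrt (by norm_num)
  have h3 : √(3 : ℝ) ^ 2 = 3 := Real.sq_sqrt (by norm_num)
  have hc : (√(3 : ℝ))⁻¹ ^ 2 = 1 / 3 := by rw [inv_pow, h3]; norm_num
  fin_cases s
  · simp at hs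
  · refine ⟨√3 / 2, by rw [div_pow, h3]; norm_num, fun a x y b z w => ?_⟩
    simp only [shiftDot, Fin.sum_univ_three, axisVec]
    simp
    linear_combination (3 * a * b + √2 ^ 2 * (-3 / 4 * x * z + 3 / 4 * √3 * (x * w - y * z)
        - √3 ^ 2 / 4 * y * w)) * hc
      + 1 / 3 * (-3 / 4 * x * z + 3 / 4 * √3 * (x * w - y * z) - √3 ^ 2 / 4 * y * w) * h2
      - 1 / 6 * y * w * h3
  · refine ⟨-(√3 / 2), by rw [neg_sq, div_pow, h3]; norm_num, fun a x y b z w => ?_⟩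
    simp only [shiftDot, Fin.sum_univ_three, axisVec]
    simp
    linear_combination (3 * a * b + √2 ^ 2 * (-3 / 4 * x * z - 3 / 4 * √3 * (x * w - y * z)
        - √3 ^ 2 / 4 * y * w)) * hc
      + 1 / 3 * (-3 / 4 * x * z - 3 / 4 * √3 * (x * w - y * z) - √3 ^ 2 / 4 * y * w) * h2
      - 1 / 6 * y * w * h3

/-- By Lagrange's identity in the plane, the norm and Gram conditions eliminate everything except a;
what remains is a quadratic in a², which is where `ha` comes from. -/
theorem sq_sum_self {a x y z w t : ℝ} (ht : t ^ 2 = 3 / 4)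
    (ha : a ^ 4 - 2 / 3 * a ^ 2 + 7 / 99 = 0)
    (hn : a ^ 2 + x ^ 2 + y ^ 2 + z ^ 2 + w ^ 2 = 1)
    (hr : a ^ 2 * (z ^ 2 + w ^ 2) + (x * w - y * z) ^ 2 = 2 / 11) :
    (a * a - (x * x + y * y) / 2 + t * (x * y - y * x)) ^ 2
      + (0 * 0 - (z * z + w * w) / 2 + t * (z * w - w * z)) ^ 2
      + (a * 0 - (x * z + y * w) / 2 + t * (x * w - y * z)) ^ 2
      + (0 * a - (z * x + w * y) / 2 + t * (z * y - w * x)) ^ 2 = 3 / 11 := by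
  have hm : x ^ 2 + y ^ 2 = 1 - a ^ 2 - (z ^ 2 + w ^ 2) := by linear_combination hn
  have h1 : (x ^ 2 + y ^ 2) * (z ^ 2 + w ^ 2) = (x * z + y * w) ^ 2 + (x * w - y * z) ^ 2 := by
    ring
  rw [hm] at h1
  have h2 : (a ^ 2 - (x ^ 2 + y ^ 2) / 2) ^ 2 + (z ^ 2 + w ^ 2) ^ 2 / 4
      + (x * z + y * w) ^ 2 / 2 + 3 / 2 * (x * w - y * z) ^ 2 = 3 / 11 := by
    rw [hm]
    linear_combination 9 / 4 * ha + hr - 1 / 2 * h1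
  linear_combination h2 + 2 * (x * w - y * z) ^ 2 * ht

/-- Here c + it is a cube root of unity, whose square is its conjugate. The second harmonic
therefore folds into the first, and `hre`, `him` kill the resulting coefficients of c and t. The
constant term is (ab)² + (1 - a²)(1 - b²)/2 = 3/11. -/
theorem sq_sum_cross {a b x y z w X Y Z W c t : ℝ}
    (hc : c ^ 2 - t ^ 2 = c) (hct : 2 * c * t = -t) (ht : c ^ 2 + t ^ 2 = 1)
    (hab : a ^ 2 + b ^ 2 = 2 / 3) (hab' : (a * b) ^ 2 = 7 / 99)
    (hn : a ^ 2 + x ^ 2 + y ^ 2 + z ^ 2 + w ^ 2 = 1)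
    (hn' : b ^ 2 + X ^ 2 + Y ^ 2 + Z ^ 2 + W ^ 2 = 1)
    (hre : 4 * (a * b) * (x * X + y * Y) + (x ^ 2 - y ^ 2 + z ^ 2 - w ^ 2)
      * (X ^ 2 - Y ^ 2 + Z ^ 2 - W ^ 2) + 4 * (x * y + z * w) * (X * Y + Z * W) = 0)
    (him : 4 * (a * b) * (y * X - x * Y) + (x ^ 2 - y ^ 2 + z ^ 2 - w ^ 2)
      * (2 * (X * Y + Z * W)) - 2 * (x * y + z * w) * (X ^ 2 - Y ^ 2 + Z ^ 2 - W ^ 2) = 0) :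
    (a * b + c * (x * X + y * Y) + t * (x * Y - y * X)) ^ 2
      + (c * (z * Z + w * W) + t * (z * W - w * Z)) ^ 2
      + (c * (x * Z + y * W) + t * (x * W - y * Z)) ^ 2
      + (c * (z * X + w * Y) + t * (z * Y - w * X)) ^ 2 = 3 / 11 := by
  have hcc : c ^ 2 = (1 + c) / 2 := by linear_combination (hc + ht) / 2
  have htt : t ^ 2 = (1 - c) / 2 := by linear_combination (ht - hc) / 2
  have h1 : (x ^ 2 + y ^ 2 + z ^ 2 + w ^ 2) * (X ^ 2 + Y ^ 2 + Z ^ 2 + W ^ 2)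
      = (1 - a ^ 2) * (1 - b ^ 2) := by
    rw [show x ^ 2 + y ^ 2 + z ^ 2 + w ^ 2 = 1 - a ^ 2 by linear_combination hn,
      show X ^ 2 + Y ^ 2 + Z ^ 2 + W ^ 2 = 1 - b ^ 2 by linear_combination hn']
  linear_combination
    ((x * X + y * Y) ^ 2 + (z * Z + w * W) ^ 2 + (x * Z + y * W) ^ 2 + (z * X + w * Y) ^ 2) * hcc
    + ((x * Y - y * X) ^ 2 + (z * W - w * Z) ^ 2 + (x * W - y * Z) ^ 2 + (z * Y - w * X) ^ 2) * htt
    + ((x * X + y * Y) * (x * Y - y * X) + (z * Z + w * W) * (z * W - w * Z)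
      + (x * Z + y * W) * (x * W - y * Z) + (z * X + w * Y) * (z * Y - w * X)) * hct
    + c / 2 * hre - t / 2 * him + h1 / 2 + 3 / 2 * hab' - hab / 2

theorem exists_isTightSimplex_of_axisVec {a b x y z w X Y Z W : ℝ}
    (hab : a ^ 2 + b ^ 2 = 2 / 3) (hab' : (a * b) ^ 2 = 7 / 99)
    (hn : a ^ 2 + x ^ 2 + y ^ 2 + z ^ 2 + w ^ 2 = 1)
    (hn' : b ^ 2 + X ^ 2 + Y ^ 2 + Z ^ 2 + W ^ 2 = 1)
    (hr : a ^ 2 * (z ^ 2 + w ^ 2) + (x * w - y * z) ^ 2 = 2 / 11)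
    (hr' : b ^ 2 * (Z ^ 2 + W ^ 2) + (X * W - Y * Z) ^ 2 = 2 / 11)
    (hd : (x * w - y * z) * (X * W - Y * Z) + a * b * (z * Z + w * W) = 0)
    (hre : 4 * (a * b) * (x * X + y * Y) + (x ^ 2 - y ^ 2 + z ^ 2 - w ^ 2)
      * (X ^ 2 - Y ^ 2 + Z ^ 2 - W ^ 2) + 4 * (x * y + z * w) * (X * Y + Z * W) = 0)
    (him : 4 * (a * b) * (y * X - x * Y) + (x ^ 2 - y ^ 2 + z ^ 2 - w ^ 2)
      * (2 * (X * Y + Z * W)) - 2 * (x * y + z * w) * (X ^ 2 - Y ^ 2 + Z ^ 2 - W ^ 2) = 0) :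
    ∃ y : Fin 12 → HP 3, IsTightSimplex y ∧ IsCyclicSymmetric (Set.range y) := by
  have ha : a ^ 4 - 2 / 3 * a ^ 2 + 7 / 99 = 0 := by linear_combination a ^ 2 * hab - hab'
  have hb : b ^ 4 - 2 / 3 * b ^ 2 + 7 / 99 = 0 := by linear_combination b ^ 2 * hab - hab'
  refine exists_isTightSimplex_of_shiftDot ![axisVec a x y, axisVec b X Y]
    ![axisVec 0 z w, axisVec 0 Z W] ?_ ?_ ?_ ?_
  · intro m
    fin_cases m <;> simp [shiftDot_zero_axisVec]
    · linear_combination hn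
    · linear_combination hn'
  · intro m
    fin_cases m <;> simp [shiftDot_zero_axisVec]
    -- (|u|² - |v|²)² + 4(u·v)² is (|u|² + |v|²)² minus four times the Gram determinant, which `hr`
    -- sets to 2/11.
    · linear_combination (a ^ 2 + x ^ 2 + y ^ 2 + z ^ 2 + w ^ 2 + 1) * hn - 4 * hr
    · linear_combination (b ^ 2 + X ^ 2 + Y ^ 2 + Z ^ 2 + W ^ 2 + 1) * hn' - 4 * hr'
  · simp [shiftDot_zero_axisVec]
    linear_combination hd
  · intro m m' s hms
    by_cases hs : s = 0
    · subst hs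
      fin_cases m <;> fin_cases m' <;> simp at hms <;> simp [shiftDot_zero_axisVec]
      · linear_combination sq_sum_cross (c := 1) (t := 0) (by norm_num) (by norm_num)
          (by norm_num) hab hab' hn hn' hre him
      · linear_combination sq_sum_cross (c := 1) (t := 0) (by norm_num) (by norm_num)
          (by norm_num) hab hab' hn hn' hre him
    · obtain ⟨t, ht, h⟩ := shiftDot_axisVec hs
      have h1 : ∀ t : ℝ, t ^ 2 = 3 / 4 → _ := fun t ht =>
        sq_sum_cross (c := -1 / 2) (t := t) (by rw [ht]; norm_num) (by ring)
          (by rw [ht]; norm_num) hab hab' hn hn' hre him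
      fin_cases m <;> fin_cases m' <;> simp [h]
      · linear_combination sq_sum_self ht ha hn hr
      · linear_combination h1 t ht
      -- Exchanging the pairs reverses the cross products, hence the sign of t.
      · linear_combination h1 (-t) (by rw [neg_sq, ht])
      · linear_combination sq_sum_self ht hb hn' hr'

/-- The case `w = 0` and `W = 0`, with the second pair of plane vectors turned by the rotation
with cosine `C` and sine `D`. -/
theorem exists_isTightSimplex_of_rotated {a b x y z X Y Z C D : ℝ}
    (hab : a ^ 2 + b ^ 2 = 2 / 3) (hab' : (a * b) ^ 2 = 7 / 99)
    (hn : a ^ 2 + x ^ 2 + y ^ 2 + z ^ 2 = 1) (hn' : b ^ 2 + X ^ 2 + Y ^ 2 + Z ^ 2 = 1)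
    (hr : (a ^ 2 + y ^ 2) * z ^ 2 = 2 / 11) (hr' : (b ^ 2 + Y ^ 2) * Z ^ 2 = 2 / 11)
    (hCD : C ^ 2 + D ^ 2 = 1) (hd : y * Y + a * b * C = 0)
    (hre : (C ^ 3 - 3 * C * D ^ 2) * ((x ^ 2 - y ^ 2 + z ^ 2) * (X ^ 2 - Y ^ 2 + Z ^ 2)
        + 2 * x * y * (2 * X * Y))
      - (3 * C ^ 2 * D - D ^ 3) * ((x ^ 2 - y ^ 2 + z ^ 2) * (2 * X * Y)
        - 2 * x * y * (X ^ 2 - Y ^ 2 + Z ^ 2)) = -(4 * (a * b) * (x * X + y * Y)))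
    (him : (C ^ 3 - 3 * C * D ^ 2) * ((x ^ 2 - y ^ 2 + z ^ 2) * (2 * X * Y)
        - 2 * x * y * (X ^ 2 - Y ^ 2 + Z ^ 2))
      + (3 * C ^ 2 * D - D ^ 3) * ((x ^ 2 - y ^ 2 + z ^ 2) * (X ^ 2 - Y ^ 2 + Z ^ 2)
        + 2 * x * y * (2 * X * Y)) = -(4 * (a * b) * (y * X - x * Y))) :
    ∃ y : Fin 12 → HP 3, IsTightSimplex y ∧ IsCyclicSymmetric (Set.range y) := by
  have h1 : (C * X - D * Y) ^ 2 + (D * X + C * Y) ^ 2 = X ^ 2 + Y ^ 2 := by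
    linear_combination (X ^ 2 + Y ^ 2) * hCD
  have h2 : (C * Z) ^ 2 + (D * Z) ^ 2 = Z ^ 2 := by linear_combination Z ^ 2 * hCD
  have h3 : (C * X - D * Y) * (D * Z) - (D * X + C * Y) * (C * Z) = -(Y * Z) := by
    linear_combination -(Y * Z) * hCD
  refine exists_isTightSimplex_of_axisVec (a := a) (b := b) (x := x) (y := y) (z := z) (w := 0)
    (X := C * X - D * Y) (Y := D * X + C * Y) (Z := C * Z) (W := D * Z) hab hab' ?_ ?_ ?_ ?_ ?_ ?_ ?_
  · linear_combination hn
  · linear_combination hn' + h1 + h2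
  · linear_combination hr
  · rw [h3, h2]
    linear_combination hr'
  · rw [h3]
    linear_combination z * Z * hd
  -- The quadratic terms turn by 2φ and the linear ones by -φ, where C + iD = e^{iφ}; `hre` and
  -- `him` are the parts of the equation multiplied by e^{iφ}, whence the triple angle.
  · linear_combination C * hre + D * him - ((C ^ 2 - D ^ 2) * ((x ^ 2 - y ^ 2 + z ^ 2)
      * (X ^ 2 - Y ^ 2 + Z ^ 2) + 2 * x * y * (2 * X * Y)) - 2 * C * D
      * ((x ^ 2 - y ^ 2 + z ^ 2) * (2 * X * Y) - 2 * x * y * (X ^ 2 - Y ^ 2 + Z ^ 2))) * hCD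
  · linear_combination C * him - D * hre - ((C ^ 2 - D ^ 2) * ((x ^ 2 - y ^ 2 + z ^ 2)
      * (2 * X * Y) - 2 * x * y * (X ^ 2 - Y ^ 2 + Z ^ 2)) + 2 * C * D
      * ((x ^ 2 - y ^ 2 + z ^ 2) * (X ^ 2 - Y ^ 2 + Z ^ 2) + 2 * x * y * (2 * X * Y))) * hCD

/-! ### The one-parameter family and its numerical bounds. -/

theorem exists_weights : ∃ g h : ℝ, g + h = 2 / 3 ∧ g * h = 7 / 99 ∧
    5343 / 10000 < g ∧ g < 5344 / 10000 ∧ 1323 / 10000 < h ∧ h < 1324 / 10000 := by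
  have h11 : √(11 : ℝ) ^ 2 = 11 := Real.sq_sqrt (by norm_num)
  have hl : 33166 / 10000 < √(11 : ℝ) := by
    apply Real.lt_sqrt_of_sq_lt
    norm_num
  have hu : √(11 : ℝ) < 33167 / 10000 := by
    rw [Real.sqrt_lt' (by norm_num)]
    norm_num
  refine ⟨1 / 3 + 2 / 33 * √11, 1 / 3 - 2 / 33 * √11, by ring, ?_, ?_, ?_, ?_, ?_⟩
  · linear_combination -4 / 1089 * h11
  all_goals linarith

theorem family_bounds {g h s p P : ℝ} (hg1 : 5343 / 10000 < g) (hg2 : g < 5344 / 10000)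
    (hh1 : 1323 / 10000 < h) (hh2 : h < 1324 / 10000) (hs0 : 0 ≤ s) (hs1 : s ≤ 1 / 10)
    (e1 : (g + s ^ 2) * p = 2 / 11) (e2 : g * p + h * P = 8 / 33) :
    333 / 1000 < p ∧ p < 341 / 1000 ∧ 1198 / 10000 < 1 - g - s ^ 2 - p ∧
      1 - g - s ^ 2 - p < 126 / 1000 ∧ 4575 / 10000 < P ∧ P < 4845 / 10000 := by
  have hss0 : 0 ≤ s ^ 2 := sq_nonneg s
  have hss1 : s ^ 2 ≤ 1 / 100 := by nlinarith
  have b1 : 3339 / 10000 < p := by nlinarith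
  have b2 : p < 3404 / 10000 := by nlinarith
  have c1 : s ^ 2 * p ≤ 1 / 100 * (3404 / 10000) :=
    mul_le_mul hss1 b2.le (by linarith) (by norm_num)
  have c2 : 0 ≤ s ^ 2 * p := mul_nonneg hss0 (by linarith)
  have e3 : h * P = 8 / 33 - 2 / 11 + s ^ 2 * p := by linear_combination e2 - e1
  have c3 : 0 < (p - 3339 / 10000) * (3404 / 10000 - p) := mul_pos (by linarith) (by linarith)
  refine ⟨by linarith, by linarith, ?_, ?_, ?_, ?_⟩ <;> nlinarith

theorem reciprocal_bounds {P w : ℝ} (hP1 : 4575 / 10000 < P) (hP2 : P < 4845 / 10000)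
    (e : w * P = 2 / 11) : 374 / 1000 < w ∧ w < 398 / 1000 ∧
      138 / 1000 < 1 - P - w ∧ 1 - P - w < 1472 / 10000 := by
  have c : 0 < (P - 4575 / 10000) * (4845 / 10000 - P) := mul_pos (by linarith) (by linarith)
  refine ⟨?_, ?_, ?_, ?_⟩ <;> nlinarith

theorem lt_sqrt_and_sqrt_lt {l t u : ℝ} (hu : 0 < u) (h1 : l ^ 2 < t) (h2 : t < u ^ 2) :
    l < √t ∧ √t < u :=
  ⟨Real.lt_sqrt_of_sq_lt h1, (Real.sqrt_lt' hu).2 h2⟩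

/-- For `s` in an interval, all the conditions on the two pairs of vectors that involve one pair
only can be solved, and the solution depends continuously on `s`. -/
theorem exists_continuous_family {g h : ℝ} (hg1 : 5343 / 10000 < g) (hg2 : g < 5344 / 10000)
    (hh1 : 1323 / 10000 < h) (hh2 : h < 1324 / 10000) :
    ∃ x z X Y Z : ℝ → ℝ, ContinuousOn x (Set.Icc 0 (1 / 10)) ∧
      ContinuousOn X (Set.Icc 0 (1 / 10)) ∧ ContinuousOn Y (Set.Icc 0 (1 / 10)) ∧
      ∀ s ∈ Set.Icc (0 : ℝ) (1 / 10),
        (346 / 1000 < x s ∧ x s < 355 / 1000) ∧ (371 / 1000 < X s ∧ X s < 384 / 1000) ∧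
        (491 / 1000 < Y s ∧ Y s < 517 / 1000) ∧
        g + x s ^ 2 + s ^ 2 + z s ^ 2 = 1 ∧ h + X s ^ 2 + Y s ^ 2 + Z s ^ 2 = 1 ∧
        (g + s ^ 2) * z s ^ 2 = 2 / 11 ∧ (h + Y s ^ 2) * Z s ^ 2 = 2 / 11 ∧
        g * z s ^ 2 + h * Z s ^ 2 = 8 / 33 := by
  have hh : h ≠ 0 := by linarith
  -- p = z² solves the first Gram condition, P = Z² the modulus condition, and w = h + Y² the second
  -- Gram condition; x and X then come from the norms.
  obtain ⟨p, hp⟩ : ∃ p : ℝ → ℝ, p = fun s => 2 / (11 * (g + s ^ 2)) := ⟨_, rfl⟩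
  obtain ⟨P, hP⟩ : ∃ P : ℝ → ℝ, P = fun s => (8 / 33 - g * p s) / h := ⟨_, rfl⟩
  obtain ⟨w, hw⟩ : ∃ w : ℝ → ℝ, w = fun s => 2 / (11 * P s) := ⟨_, rfl⟩
  have hI : ∀ s ∈ Set.Icc (0 : ℝ) (1 / 10), (g + s ^ 2) * p s = 2 / 11 ∧
      g * p s + h * P s = 8 / 33 ∧ w s * P s = 2 / 11 ∧
      333 / 1000 < p s ∧ p s < 341 / 1000 ∧
      1198 / 10000 < 1 - g - s ^ 2 - p s ∧ 1 - g - s ^ 2 - p s < 126 / 1000 ∧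
      4575 / 10000 < P s ∧ P s < 4845 / 10000 ∧
      374 / 1000 < w s ∧ w s < 398 / 1000 ∧
      138 / 1000 < 1 - P s - w s ∧ 1 - P s - w s < 1472 / 10000 := by
    rintro s ⟨hs0, hs1⟩
    have hg : g + s ^ 2 ≠ 0 := by nlinarith
    have e1 : (g + s ^ 2) * p s = 2 / 11 := by
      rw [hp]
      field_simp
    have e2 : g * p s + h * P s = 8 / 33 := by
      rw [hP]
      field_simp
      ring
    obtain ⟨b1, b2, b7, b8, b3, b4⟩ := family_bounds hg1 hg2 hh1 hh2 hs0 hs1 e1 e2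
    have e3 : w s * P s = 2 / 11 := by
      have : P s ≠ 0 := by linarith
      rw [hw]
      field_simp
    exact ⟨e1, e2, e3, b1, b2, b7, b8, b3, b4, reciprocal_bounds b3 b4 e3⟩
  have cp : ContinuousOn p (Set.Icc 0 (1 / 10)) := by
    rw [hp]
    refine ContinuousOn.div (by fun_prop) (by fun_prop) fun s _ => ?_
    nlinarith [sq_nonneg s]
  have cP : ContinuousOn P (Set.Icc 0 (1 / 10)) := by
    rw [hP]
    fun_prop
  have cw : ContinuousOn w (Set.Icc 0 (1 / 10)) := by
    rw [hw]
    refine ContinuousOn.div (by fun_prop) (by fun_prop) fun s hs => ?_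
    have := (hI s hs).2.2.2.2.2.2.2.1
    linarith
  refine ⟨fun s => √(1 - g - s ^ 2 - p s), fun s => √(p s), fun s => √(1 - P s - w s),
    fun s => √(w s - h), fun s => √(P s), by fun_prop, by fun_prop, by fun_prop, fun s hs => ?_⟩
  obtain ⟨e1, e2, e3, b1, b2, b7, b8, b3, b4, b5, b6, b9, b10⟩ := hI s hs
  have hs0 : 0 ≤ s ^ 2 := sq_nonneg s
  have hs1 : s ^ 2 ≤ 1 / 100 := by nlinarith [hs.1, hs.2]
  simp only
  rw [Real.sq_sqrt (by linarith), Real.sq_sqrt (by linarith), Real.sq_sqrt (by linarith),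
    Real.sq_sqrt (by linarith), Real.sq_sqrt (by linarith)]
  refine ⟨lt_sqrt_and_sqrt_lt (by norm_num) (by linarith) (by linarith),
    lt_sqrt_and_sqrt_lt (by norm_num) (by linarith) (by linarith),
    lt_sqrt_and_sqrt_lt (by norm_num) (by linarith) (by linarith),
    by ring, by ring, e1, by linear_combination e3, e2⟩

theorem rotation_bounds {C D : ℝ} (c1 : C ≤ 0) (c2 : -1 / 5 < C) (c3 : C ^ 2 + D ^ 2 = 1)
    (c4 : D ≤ 0) : 0 ≤ C ^ 3 - 3 * C * D ^ 2 ∧ 0 < 3 * C ^ 2 * D - D ^ 3 ∧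
      3 * C ^ 2 * D - D ^ 3 ≤ 1 := by
  have c5 : C ^ 2 < 1 / 25 := by nlinarith
  have d1 : D < -9 / 10 := by nlinarith
  have d2 : -1 ≤ D := by nlinarith
  have c6 : C ^ 3 - 3 * C * D ^ 2 = -C * (3 - 4 * C ^ 2) := by linear_combination -3 * C * c3
  have d3 : 3 * C ^ 2 * D - D ^ 3 = -D * (1 - 4 * C ^ 2) := by linear_combination -D * c3
  rw [c6, d3]
  exact ⟨mul_nonneg (by linarith) (by linarith), mul_pos (by linarith) (by linarith),
    mul_le_one₀ (by linarith) (by linarith) (by linarith [sq_nonneg C])⟩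

theorem product_bounds {g h s x X Y : ℝ} (hg1 : 5343 / 10000 < g) (hg2 : g < 5344 / 10000)
    (hh1 : 1323 / 10000 < h) (hh2 : h < 1324 / 10000) (hs0 : 0 ≤ s) (hs1 : s ≤ 1 / 10)
    (hx : 346 / 1000 < x ∧ x < 355 / 1000) (hX : 371 / 1000 < X ∧ X < 384 / 1000)
    (hY : 491 / 1000 < Y ∧ Y < 517 / 1000) :
    0 < (1 - g - 2 * s ^ 2) * (1 - h - 2 * Y ^ 2) + 2 * x * s * (2 * X * Y) ∧
      0 < (1 - g - 2 * s ^ 2) * (2 * X * Y) - 2 * x * s * (1 - h - 2 * Y ^ 2) := by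
  obtain ⟨⟨hx1, hx2⟩, ⟨hX1, hX2⟩, ⟨hY1, hY2⟩⟩ := And.intro hx (And.intro hX hY)
  have a1 : 44 / 100 < 1 - g - 2 * s ^ 2 := by nlinarith
  have a2 : 33 / 100 < 1 - h - 2 * Y ^ 2 := by nlinarith
  have a3 : 1 - h - 2 * Y ^ 2 < 39 / 100 := by nlinarith
  have a4 : 36 / 100 < 2 * X * Y := by nlinarith
  have a5 : 2 * x * s ≤ 71 / 1000 := by nlinarith
  have a6 : 0 ≤ 2 * x * s := mul_nonneg (by linarith) hs0
  have m1 : (44 / 100) * (36 / 100) ≤ (1 - g - 2 * s ^ 2) * (2 * X * Y) :=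
    mul_le_mul a1.le a4.le (by norm_num) (by linarith)
  have m2 : 2 * x * s * (1 - h - 2 * Y ^ 2) ≤ 71 / 1000 * (39 / 100) :=
    mul_le_mul a5 a3.le (by linarith) (by norm_num)
  exact ⟨add_pos_of_pos_of_nonneg (mul_pos (by linarith) (by linarith))
    (mul_nonneg a6 (by linarith)), by linarith⟩

/-- Given the norm and Gram conditions, this reduces to `hz`. As `hz` is symmetric in the two pairs,
it also gives the identity with the pairs exchanged, and the two multiply to |K|² = |L|². -/
theorem modulus_eq {g h x y z X Y Z : ℝ} (hgh : g + h = 2 / 3) (hgh' : g * h = 7 / 99)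
    (n1 : g + x ^ 2 + y ^ 2 + z ^ 2 = 1) (n2 : h + X ^ 2 + Y ^ 2 + Z ^ 2 = 1)
    (r : (g + y ^ 2) * z ^ 2 = 2 / 11) (hz : g * z ^ 2 + h * Z ^ 2 = 8 / 33) :
    (1 - g - 2 * y ^ 2) ^ 2 + (2 * x * y) ^ 2 = 4 * h * (X ^ 2 + Y ^ 2) := by
  have hx : x ^ 2 = 1 - g - y ^ 2 - z ^ 2 := by linear_combination n1
  rw [mul_pow, mul_pow, hx]
  linear_combination -4 * r + 4 * hz - 4 * h * n2 + (g - h - 4 / 3) * hgh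
    + 5 * (h * hgh - hgh')

theorem endpoint_nonneg {g h q x X Y E F : ℝ} (hg1 : 5343 / 10000 < g)
    (hg2 : g < 5344 / 10000) (hh1 : 1323 / 10000 < h) (hh2 : h < 1324 / 10000)
    (hq : 2659 / 10000 < q) (hE : 0 ≤ E) (hF1 : F ≤ 1)
    (hx : 346 / 1000 < x ∧ x < 355 / 1000) (hX : 371 / 1000 < X ∧ X < 384 / 1000)
    (hY : 491 / 1000 < Y ∧ Y < 517 / 1000) :
    0 ≤ E * ((1 - g - 2 * (1 / 10) ^ 2) * (1 - h - 2 * Y ^ 2) + 2 * x * (1 / 10) * (2 * X * Y))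
      - F * ((1 - g - 2 * (1 / 10) ^ 2) * (2 * X * Y) - 2 * x * (1 / 10) * (1 - h - 2 * Y ^ 2))
      + 4 * q * (x * X + 1 / 10 * Y) := by
  obtain ⟨k1, k2⟩ := product_bounds (s := 1 / 10) hg1 hg2 hh1 hh2 (by norm_num) le_rfl hx hX hY
  obtain ⟨⟨hx1, hx2⟩, ⟨hX1, hX2⟩, ⟨hY1, hY2⟩⟩ := And.intro hx (And.intro hX hY)
  have hα : 0 < 1 - h - 2 * Y ^ 2 := by nlinarith
  have e1 : 0 ≤ 2 * x * (1 / 10) * (1 - h - 2 * Y ^ 2) := mul_nonneg (by linarith) hα.le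
  have m2 : X * Y ≤ 384 / 1000 * (517 / 1000) :=
    mul_le_mul hX2.le hY2.le (by linarith) (by norm_num)
  have e2 : (1 - g - 2 * (1 / 10) ^ 2) * (2 * X * Y)
      ≤ 447 / 1000 * (2 * (384 / 1000 * (517 / 1000))) :=
    mul_le_mul (by linarith) (by linarith) (by nlinarith) (by norm_num)
  have m3 : 346 / 1000 * (371 / 1000) ≤ x * X :=
    mul_le_mul hx1.le hX1.le (by norm_num) (by linarith)
  have m4 : 2659 / 10000 * (346 / 1000 * (371 / 1000) + 1 / 10 * (491 / 1000))
      ≤ q * (x * X + 1 / 10 * Y) :=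
    mul_le_mul hq.le (by linarith) (by norm_num) (by linarith)
  have m5 := mul_le_mul_of_nonneg_right hF1 k2.le
  have m6 := mul_nonneg hE k1.le
  linarith

/-! ### The intermediate value argument. -/

theorem exists_isTightSimplex_cyclic :
    ∃ y : Fin 12 → HP 3, IsTightSimplex y ∧ IsCyclicSymmetric (Set.range y) := by
  obtain ⟨g, h, hgh, hgh', hg1, hg2, hh1, hh2⟩ := exists_weights
  have hga : √g ^ 2 = g := Real.sq_sqrt (by linarith)
  have hhb : √h ^ 2 = h := Real.sq_sqrt (by linarith)
  obtain ⟨q, hqd⟩ : ∃ q : ℝ, q = √g * √h := ⟨_, rfl⟩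
  have hq0 : 0 ≤ q := hqd ▸ mul_nonneg (Real.sqrt_nonneg _) (Real.sqrt_nonneg _)
  have hq : q ^ 2 = 7 / 99 := by rw [hqd, mul_pow, hga, hhb, hgh']
  have hq1 : 2659 / 10000 < q := by nlinarith
  have hq2 : q < 266 / 1000 := by nlinarith
  obtain ⟨x, z, X, Y, Z, cx, cX, cY, hI⟩ := exists_continuous_family hg1 hg2 hh1 hh2
  -- C is forced by the orthogonality condition `hd`; the negative root for D makes the sine of the
  -- triple angle positive, which settles the sign of the imaginary part below.
  obtain ⟨C, hC⟩ : ∃ C : ℝ → ℝ, C = fun s => -(s * Y s) / q := ⟨_, rfl⟩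
  obtain ⟨D, hD⟩ : ∃ D : ℝ → ℝ, D = fun s => -√(1 - C s ^ 2) := ⟨_, rfl⟩
  have cC : ContinuousOn C (Set.Icc 0 (1 / 10)) := by
    rw [hC]
    fun_prop
  have cD : ContinuousOn D (Set.Icc 0 (1 / 10)) := by
    rw [hD]
    fun_prop
  have hCD : ∀ s ∈ Set.Icc (0 : ℝ) (1 / 10), s * Y s + q * C s = 0 ∧ C s ≤ 0 ∧ -1 / 5 < C s ∧
      C s ^ 2 + D s ^ 2 = 1 ∧ D s ≤ 0 := by
    rintro s hs
    obtain ⟨-, -, ⟨hY1, hY2⟩, -⟩ := hI s hs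
    obtain ⟨hs0, hs1⟩ := hs
    have e1 : s * Y s + q * C s = 0 := by
      have : q ≠ 0 := by linarith
      rw [hC]
      field_simp
      ring
    have e2 : s * Y s ≤ 1 / 10 * (517 / 1000) :=
      mul_le_mul hs1 hY2.le (by linarith) (by norm_num)
    have e3 : 0 ≤ s * Y s := mul_nonneg hs0 (by linarith)
    have b1 : C s ≤ 0 := by nlinarith
    have b2 : -1 / 5 < C s := by nlinarith
    refine ⟨e1, b1, b2, ?_, ?_⟩
    · rw [hD]
      simp only
      rw [neg_sq, Real.sq_sqrt (by nlinarith)]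
      ring
    · rw [hD]
      simp [Real.sqrt_nonneg]
  let R : ℝ → ℝ := fun s => (1 - g - 2 * s ^ 2) * (1 - h - 2 * Y s ^ 2)
    + 2 * x s * s * (2 * X s * Y s)
  let M : ℝ → ℝ := fun s => (1 - g - 2 * s ^ 2) * (2 * X s * Y s)
    - 2 * x s * s * (1 - h - 2 * Y s ^ 2)
  let f : ℝ → ℝ := fun s => (C s ^ 3 - 3 * C s * D s ^ 2) * R s
    - (3 * C s ^ 2 * D s - D s ^ 3) * M s + 4 * q * (x s * X s + s * Y s)
  have cf : ContinuousOn f (Set.Icc 0 (1 / 10)) := by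
    simp only [f, R, M]
    fun_prop
  have hE : ∀ s ∈ Set.Icc (0 : ℝ) (1 / 10), 0 ≤ C s ^ 3 - 3 * C s * D s ^ 2 ∧
      0 < 3 * C s ^ 2 * D s - D s ^ 3 ∧ 3 * C s ^ 2 * D s - D s ^ 3 ≤ 1 ∧ 0 < R s ∧ 0 < M s := by
    intro s hs
    obtain ⟨hx, hX, hY, -⟩ := hI s hs
    obtain ⟨-, c1, c2, c3, c4⟩ := hCD s hs
    obtain ⟨k1, k2, k3⟩ := rotation_bounds c1 c2 c3 c4
    exact ⟨k1, k2, k3, product_bounds hg1 hg2 hh1 hh2 hs.1 hs.2 hx hX hY⟩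
  have f0 : f 0 ≤ 0 := by
    obtain ⟨⟨hx1, hx2⟩, ⟨hX1, hX2⟩, ⟨hY1, hY2⟩, -⟩ := hI 0 (by norm_num)
    have hC0 : C 0 = 0 := by simp [hC]
    have hD0 : D 0 = -1 := by simp [hD, hC0]
    have e : f 0 = 4 * X 0 * (q * x 0 - (1 - g) * Y 0 / 2) := by
      simp only [f, R, M, hC0, hD0]
      ring
    rw [e]
    refine mul_nonpos_of_nonneg_of_nonpos (by linarith) ?_
    nlinarith
  have f1 : 0 ≤ f (1 / 10) := by
    have h1 : (1 / 10 : ℝ) ∈ Set.Icc (0 : ℝ) (1 / 10) := by norm_num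
    obtain ⟨hx, hX, hY, -⟩ := hI _ h1
    obtain ⟨k1, -, k3, -, -⟩ := hE _ h1
    exact endpoint_nonneg hg1 hg2 hh1 hh2 hq1 k1 k3 hx hX hY
  obtain ⟨s, hs, hfs⟩ := intermediate_value_Icc (by norm_num) cf ⟨f0, f1⟩
  obtain ⟨⟨hx1, hx2⟩, ⟨hX1, hX2⟩, ⟨hY1, hY2⟩, n1, n2, r1, r2, hpP⟩ := hI s hs
  obtain ⟨hd, -, -, hcd, -⟩ := hCD s hs
  obtain ⟨hE1, hE2, -, hR, hM⟩ := hE s hs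
  have hα : x s ^ 2 - s ^ 2 + z s ^ 2 = 1 - g - 2 * s ^ 2 := by linear_combination n1
  have hα' : X s ^ 2 - Y s ^ 2 + Z s ^ 2 = 1 - h - 2 * Y s ^ 2 := by linear_combination n2
  have him : (C s ^ 3 - 3 * C s * D s ^ 2) * M s + (3 * C s ^ 2 * D s - D s ^ 3) * R s
      = -(4 * q * (s * X s - x s * Y s)) := by
    have e1 := modulus_eq hgh hgh' n1 n2 r1 hpP
    have e2 := modulus_eq (by linarith) (by linarith) n2 (z := Z s) (X := x s) (Y := s) (Z := z s) n1 r2 (by linarith)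
    have e3 : R s ^ 2 + M s ^ 2 = 16 * q ^ 2 * (x s ^ 2 + s ^ 2) * (X s ^ 2 + Y s ^ 2) := by
      have : R s ^ 2 + M s ^ 2 = ((1 - g - 2 * s ^ 2) ^ 2 + (2 * x s * s) ^ 2)
          * ((1 - h - 2 * Y s ^ 2) ^ 2 + (2 * X s * Y s) ^ 2) := by
        simp only [R, M]
        ring
      rw [this, e1, e2, hq, ← hgh']
      ring
    have e4 : (C s ^ 3 - 3 * C s * D s ^ 2) ^ 2 + (3 * C s ^ 2 * D s - D s ^ 3) ^ 2 = 1 := by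
      have : (C s ^ 3 - 3 * C s * D s ^ 2) ^ 2 + (3 * C s ^ 2 * D s - D s ^ 3) ^ 2
          = (C s ^ 2 + D s ^ 2) ^ 3 := by ring
      rw [this, hcd, one_pow]
    have e5 : (C s ^ 3 - 3 * C s * D s ^ 2) * R s - (3 * C s ^ 2 * D s - D s ^ 3) * M s
        = -(4 * q * (x s * X s + s * Y s)) := by linear_combination hfs
    have h1 : 0 ≤ -(4 * q * (s * X s - x s * Y s)) := by
      have : s * X s ≤ x s * Y s :=
        mul_le_mul (by linarith [hs.2]) (by linarith) (by linarith) (by linarith)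
      have := mul_nonneg hq0 (sub_nonneg.2 this)
      linarith
    have h2 := add_nonneg (mul_nonneg hE1 hM.le) (mul_nonneg hE2.le hR.le)
    -- Equal moduli and equal real parts give equal squares of the imaginary parts, and both of
    -- these are nonnegative.
    refine (sq_eq_sq₀ h2 h1).1 ?_
    linear_combination (R s ^ 2 + M s ^ 2) * e4 + e3 - (((C s ^ 3 - 3 * C s * D s ^ 2) * R s
      - (3 * C s ^ 2 * D s - D s ^ 3) * M s) - 4 * q * (x s * X s + s * Y s)) * e5
  refine exists_isTightSimplex_of_rotated (a := √g) (b := √h) (x := x s) (y := s) (z := z s)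
    (X := X s) (Y := Y s) (Z := Z s) (C := C s) (D := D s) ?_ ?_ ?_ ?_ ?_ ?_ hcd ?_ ?_ ?_
  · rw [hga, hhb, hgh]
  · rw [← hqd, hq]
  · rw [hga, n1]
  · rw [hhb, n2]
  · rw [hga, r1]
  · rw [hhb, r2]
  · rw [← hqd, hd]
  · rw [hα, hα', ← hqd]
    linear_combination hfs
  · rw [hα, hα', ← hqd]
    exact him

end TightSimplex

end

theorem mainTheorem8 :
    ∃ x : Fin 12 → TightSimplex.HP 3,
      TightSimplex.IsTightSimplex x ∧ TightSimplex.IsCyclicSymmetric (Set.range x) :=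
  TightSimplex.exists_isTightSimplex_cyclic
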